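/- Let $p<0$ and $\alpha>0$. For every sequence $(a_n)_{n\ge 1}$ of nonnegative real numbers with $\sum_{n\ge1} a_n<\infty$, the series on the left below converges and $$\sum_{n=1}^{\infty}\left(\frac{\sum_{i=1}^{n} i^{\alpha-1}a_i^{1/p}}{\sum_{i=1}^{n} i^{\alpha-1}}\right)^{p}\le\left(\frac{\alpha p}{\alpha p-1}\right)^{p}\sum_{n=1}^{\infty}a_n ,$$ where the $n$-th term on the left is understood to be $0$ if one of $a_1,\dots,a_n$ is $0$. Moreover, for $0<\alpha<1$ (the nontrivial cases of Bennett's conjecture on the weighted Carleman inequality; they arise from the inequality above, with $\alpha+1$ in place of $\alpha$, as $p\to-\infty$), for every sequence $(a_n)_{n\ge1}$ of nonnegative real numbers with $\sum_{n\ge1} a_n<\infty$, the series on the left below converges and $$\sum_{n=1}^{\infty}\ \prod_{k=1}^{n} a_k^{\,k^{\alpha}/\sum_{i=1}^{n} i^{\alpha}}\le e^{1/(\alpha+1)}\sum_{n=1}^{\infty}a_n .$$ -/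

import Mathlib

open scoped BigOperators

/-- The weighted mean `(∑_{i=1}^n w_i x_i) / (∑_{i=1}^n w_i)`. Sequences are indexed by `1, 2, 3, …`;
the value at the index `0` is never used. -/
noncomputable def weightedMean (w x : ℕ → ℝ) (n : ℕ) : ℝ :=
  (∑ i ∈ Finset.Icc 1 n, w i * x i) / (∑ i ∈ Finset.Icc 1 n, w i)

/-- The expression `((∑_{i=1}^n w_i a_i^{1/p}) / (∑_{i=1}^n w_i))^p`, meant for `p < 0` and a
nonnegative sequence `a`. If one of `a_1, …, a_n` is zero, then `a_i^{1/p}` is infinite there, and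
the value is `0`, the limit along positive sequences. -/
noncomputable def weightedPowerMean (w : ℕ → ℝ) (p : ℝ) (a : ℕ → ℝ) (n : ℕ) : ℝ :=
  open scoped Classical in
  if ∃ i ∈ Finset.Icc 1 n, a i = 0 then 0
  else (weightedMean w (fun i => a i ^ (1 / p)) n) ^ p

/-- The weighted geometric mean `∏_{k=1}^n a_k^{w_k / W_n}` with `W_n = ∑_{i=1}^n w_i`. -/
noncomputable def weightedGeomMean (w a : ℕ → ℝ) (n : ℕ) : ℝ :=
  ∏ k ∈ Finset.Icc 1 n, a k ^ (w k / ∑ i ∈ Finset.Icc 1 n, w i)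

/-!
Write `W_n = w_1 + ⋯ + w_n` and `b_n = W_n / w_n`; for the weights `w_n = n ^ (α - 1)` the ratio
`b_n` is asymptotic to `n / α`. Both inequalities follow, for arbitrary positive weights, from a
bound on the growth of `b_n`, by an induction that keeps track of a slack term.

For negative powers put `p = -r`, `x_n = a_n ^ (1 / p)`, `δ = 1 / (α r)`, and let `A_n` be the
weighted mean of `x_1, …, x_n`. Then `b_n A_n = (b_n - 1) A_{n-1} + x_n`, and convexity of
`t ↦ t ^ (-r)`, applied with the weights `(b_n - 1) / (b_n + δ)` and `(1 + δ) / (b_n + δ)` to the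
points `A_{n-1}` and `x_n / (1 + δ)`, gives
`(b_n + δ) / (1 + δ) * (1 + δ / b_n) ^ r * A_n ^ (-r)`
`≤ (b_n - 1) / (1 + δ) * A_{n-1} ^ (-r) + (1 + δ) ^ r * x_n ^ (-r)`.
These inequalities telescope as soon as `b_{n+1} + δ ≤ (b_n + δ) (1 + δ / b_n) ^ r`, and their sum is
`sum_weightedMean_rpow_neg_add_le`, with the constant `(1 + δ) ^ r = (α p / (α p - 1)) ^ p`. In the
same way the inequality between the arithmetic and the geometric mean yields
`sum_weightedGeomMean_add_le` from `b_{n+1} ≤ b_n exp (M / b_n)`; this is used with `M = 1 / (α + 1)`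
for the weights `n ^ α`, so no limit `p → -∞` has to be taken.

Both growth conditions follow from `b_{n+1} ≤ b_n + 1 / α`, which holds for `α ≤ 1` and for `α ≥ 2`
but fails for `1 < α < 2` at `n = 1`. When `α ≥ 1` it is enough that
`b_{n+1} ≤ b_n + 1 / α + 1 / (2 α ^ 2 b_n)`, since `y = 1 / (α b_n)` is at most `1`
and `1 + y + y ^ 2 / 2 ≤ exp y`, respectively `1 + y + y / r + y ^ 2 / 2 ≤ (1 + y / r) ^ (1 + r)`
(`quadratic_le_rpow_one_add`). For `1 ≤ α ≤ 2` this weaker bound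
(`sumRatio_powerWeight_le_of_one_le_of_le_two`) follows from `(n + α - 1) / α ≤ b_n ≤ n`.
-/

open Finset

/-! ### Bernoulli type inequalities and convexity of negative powers -/

/-- The graph of `t ↦ t ^ (-r)` lies above its tangent line at `1`. -/
theorem one_sub_mul_le_rpow_neg {t r : ℝ} (ht : 0 < t) (hr : 0 ≤ r) :
    1 - r * (t - 1) ≤ t ^ (-r) := by
  rw [Real.rpow_def_of_pos ht]
  have h1 := Real.add_one_le_exp (Real.log t * -r)
  have h2 := mul_le_mul_of_nonneg_left (Real.log_le_sub_one_of_pos ht) hr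
  linarith

theorem rpow_neg_convex_comb_le {c d u v r : ℝ} (hc : 0 ≤ c) (hd : 0 ≤ d) (hcd : c + d = 1)
    (hu : 0 < u) (hv : 0 < v) (hr : 0 ≤ r) :
    (c * u + d * v) ^ (-r) ≤ c * u ^ (-r) + d * v ^ (-r) := by
  -- average the tangent line bound at the point `m = c * u + d * v`
  obtain ⟨m, hm⟩ : ∃ m, m = c * u + d * v := ⟨_, rfl⟩
  have hm0 : 0 < m := by
    rw [hm]
    rcases hc.eq_or_lt with h | h
    · have : d = 1 := by linarith
      subst h; subst this; simpa using hv
    · have := mul_pos h hu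
      have := mul_nonneg hd hv.le
      linarith
  have key : ∀ t, 0 < t → m ^ (-r) * (1 - r * (t / m - 1)) ≤ t ^ (-r) := by
    intro t ht
    have h := one_sub_mul_le_rpow_neg (div_pos ht hm0) hr
    rw [Real.div_rpow ht.le hm0.le, le_div_iff₀ (Real.rpow_pos_of_pos hm0 _)] at h
    linarith
  have h1 := mul_le_mul_of_nonneg_left (key u hu) hc
  have h2 := mul_le_mul_of_nonneg_left (key v hv) hd
  rw [← hm]
  have h3 : c * (m ^ (-r) * (1 - r * (u / m - 1))) + d * (m ^ (-r) * (1 - r * (v / m - 1)))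
      = m ^ (-r) * ((c + d) - r * ((c * u + d * v) / m - (c + d))) := by ring
  rw [hcd, ← hm, div_self hm0.ne'] at h3
  linarith

/-- For `r < 1` the coefficient of the square in the expansion of the right side exceeds `1 / 2`,
and the restriction to `y ≤ 1` keeps the negative cubic term harmless, however small `r` is. -/
theorem quadratic_le_rpow_one_add {r y : ℝ} (hr : 0 < r) (hy0 : 0 ≤ y) (hy1 : y ≤ 1) :
    1 + y + y / r + y ^ 2 / 2 ≤ (1 + y / r) ^ (1 + r) := by
  let f : ℝ → ℝ := fun y => (1 + y / r) ^ (1 + r) - (1 + y + y / r + y ^ 2 / 2)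
  let f' : ℝ → ℝ := fun y => 1 / r * (1 + r) * (1 + y / r) ^ (1 + r - 1) - (1 + 1 / r + y)
  have hd : ∀ y, 0 ≤ y → HasDerivAt f (f' y) y := by
    intro y hy
    have hpos : 0 < 1 + y / r := by positivity
    have h1 : HasDerivAt (fun y : ℝ => 1 + y / r) (1 / r) y :=
      ((hasDerivAt_id y).div_const r).const_add 1
    have h2 := h1.rpow_const (p := 1 + r) (Or.inl hpos.ne')
    have h3 : HasDerivAt (fun y : ℝ => 1 + y + y / r + y ^ 2 / 2) (1 + 1 / r + y) y := by
      have h4 := (((hasDerivAt_id y).const_add 1).add ((hasDerivAt_id y).div_const r)).add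
        (((hasDerivAt_id y).pow 2).div_const 2)
      exact h4.congr_deriv (by norm_num)
    exact h2.sub h3
  have hmono : MonotoneOn f (Set.Icc 0 1) := by
    refine monotoneOn_of_deriv_nonneg (convex_Icc 0 1)
      (fun y hy => (hd y hy.1).continuousAt.continuousWithinAt)
      (fun y hy => (hd y (interior_subset hy).1).differentiableAt.differentiableWithinAt) ?_
    intro y hy
    obtain ⟨hy0, hy1⟩ := interior_subset hy
    rw [(hd y hy0).deriv]
    have hpos : 0 < 1 + y / r := by positivity
    -- the tangent line bound for `t ↦ t ^ (-r)` at `t = (1 + y / r)⁻¹`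
    have h := one_sub_mul_le_rpow_neg (inv_pos.2 hpos) hr.le
    rw [Real.inv_rpow hpos.le, Real.rpow_neg hpos.le, inv_inv] at h
    have e : 1 - r * ((1 + y / r)⁻¹ - 1) = 1 + r * y / (r + y) := by
      have : 0 < r + y := by positivity
      field_simp
      ring
    have h5 : r * y / (1 + r) ≤ r * y / (r + y) := by
      apply div_le_div_of_nonneg_left <;> first | positivity | linarith
    have h6 : 1 / r * (1 + r) * (1 + r * y / (1 + r)) = 1 + 1 / r + y := by
      field_simp
      ring
    have h7 : 1 / r * (1 + r) * (1 + r * y / (1 + r)) ≤ 1 / r * (1 + r) * (1 + y / r) ^ r :=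
      mul_le_mul_of_nonneg_left (by linarith) (by positivity)
    simp only [f', add_sub_cancel_left]
    linarith
  have h := hmono ⟨le_rfl, zero_le_one⟩ ⟨hy0, hy1⟩ hy0
  simp only [f] at h
  norm_num at h
  linarith

/-! ### Criteria in terms of the ratios `W_n / w_n` -/

/-- The ratio `W_n / w_n` of the partial sum `W_n = w_1 + ⋯ + w_n` of the weights to the last
weight. -/
noncomputable def sumRatio (w : ℕ → ℝ) (n : ℕ) : ℝ := (∑ i ∈ Icc 1 n, w i) / w n

section Criteria

variable {w : ℕ → ℝ}

theorem sum_Icc_pos (hw : ∀ n, 1 ≤ n → 0 < w n) (n : ℕ) : 0 < ∑ i ∈ Icc 1 (n + 1), w i :=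
  sum_pos (fun i hi => hw i (mem_Icc.1 hi).1) ⟨1, by simp⟩

theorem one_le_sumRatio (hw : ∀ n, 1 ≤ n → 0 < w n) (n : ℕ) : 1 ≤ sumRatio w (n + 1) := by
  rw [sumRatio, one_le_div (hw _ (by simp))]
  exact single_le_sum (fun i hi => (hw i (mem_Icc.1 hi).1).le) (by simp)

theorem sumRatio_one (hw : ∀ n, 1 ≤ n → 0 < w n) : sumRatio w 1 = 1 := by
  simp [sumRatio, (hw 1 le_rfl).ne']

theorem sumRatio_succ (hw : ∀ n, 1 ≤ n → 0 < w n) (n : ℕ) :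
    sumRatio w (n + 2) = 1 + sumRatio w (n + 1) * (w (n + 1) / w (n + 2)) := by
  have h1 := (hw (n + 1) (by simp)).ne'
  have h2 := (hw (n + 2) (by simp)).ne'
  rw [sumRatio, sumRatio, sum_Icc_succ_top (by simp)]
  field_simp
  ring

theorem weightedMean_one (hw : ∀ n, 1 ≤ n → 0 < w n) (x : ℕ → ℝ) : weightedMean w x 1 = x 1 := by
  simp [weightedMean, (hw 1 le_rfl).ne']

/-- The recurrence `b_n A_n = (b_n - 1) A_{n-1} + x_n` of the means, free of the weights
themselves. -/
theorem weightedMean_succ (hw : ∀ n, 1 ≤ n → 0 < w n) (x : ℕ → ℝ) (n : ℕ) :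
    sumRatio w (n + 2) * weightedMean w x (n + 2)
      = (sumRatio w (n + 2) - 1) * weightedMean w x (n + 1) + x (n + 2) := by
  have h1 := (hw (n + 2) (by simp)).ne'
  have h2 := (sum_Icc_pos hw n).ne'
  have h3 := (sum_Icc_pos hw (n + 1)).ne'
  have e1 : ∑ i ∈ Icc 1 (n + 2), w i = ∑ i ∈ Icc 1 (n + 1), w i + w (n + 2) :=
    sum_Icc_succ_top (by simp) _
  have e2 : ∑ i ∈ Icc 1 (n + 2), w i * x i
      = ∑ i ∈ Icc 1 (n + 1), w i * x i + w (n + 2) * x (n + 2) := sum_Icc_succ_top (by simp) _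
  simp only [sumRatio, weightedMean, e2]
  rw [e1] at h3 ⊢
  field_simp
  ring

theorem weightedMean_pos (hw : ∀ n, 1 ≤ n → 0 < w n) {x : ℕ → ℝ} {n : ℕ}
    (hx : ∀ i ∈ Icc 1 (n + 1), 0 < x i) : 0 < weightedMean w x (n + 1) :=
  div_pos (sum_pos (fun i hi => mul_pos (hw i (mem_Icc.1 hi).1) (hx i hi)) ⟨1, by simp⟩)
    (sum_Icc_pos hw n)

/-- The growth condition on the ratios implies the inequality for negative powers. The second
summand on the left is the slack that makes the induction on `N` close. -/
theorem sum_weightedMean_rpow_neg_add_le (hw : ∀ n, 1 ≤ n → 0 < w n) {r δ : ℝ} (hr : 0 < r)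
    (hδ : 0 < δ)
    (hb : ∀ n, sumRatio w (n + 2) + δ
      ≤ (sumRatio w (n + 1) + δ) * (1 + δ / sumRatio w (n + 1)) ^ r)
    {x : ℕ → ℝ} (N : ℕ) (hx : ∀ i ∈ Icc 1 (N + 1), 0 < x i) :
    ∑ n ∈ range (N + 1), weightedMean w x (n + 1) ^ (-r)
        + (sumRatio w (N + 2) - 1) / (1 + δ) * weightedMean w x (N + 1) ^ (-r)
      ≤ (1 + δ) ^ r * ∑ n ∈ range (N + 1), x (n + 1) ^ (-r) := by
  have hκ : 0 < 1 + δ := by linarith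
  -- the growth condition, rewritten for the slack terms
  have hcrit : ∀ n (A : ℝ), 0 ≤ A → A + (sumRatio w (n + 2) - 1) / (1 + δ) * A
      ≤ (sumRatio w (n + 1) + δ) / (1 + δ) * ((1 + δ / sumRatio w (n + 1)) ^ r * A) := by
    intro n A hA
    have h := mul_le_mul_of_nonneg_right (hb n) (div_nonneg hA hκ.le)
    calc A + (sumRatio w (n + 2) - 1) / (1 + δ) * A
        = (sumRatio w (n + 2) + δ) * (A / (1 + δ)) := by field_simp; ring
      _ ≤ _ := h
      _ = _ := by ring
  induction N with
  | zero =>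
    have h0 := hcrit 0 (x 1 ^ (-r)) (Real.rpow_nonneg (hx 1 (by simp)).le _)
    simp only [zero_add, sumRatio_one hw, div_one, div_self hκ.ne', one_mul] at h0
    simpa [weightedMean_one hw] using h0
  | succ N ih =>
    have ih := ih fun i hi => hx i (Icc_subset_Icc_right (by simp) hi)
    have hA := weightedMean_pos hw hx
    have hA' : 0 < weightedMean w x (N + 1) :=
      weightedMean_pos hw fun i hi => hx i (Icc_subset_Icc_right (by simp) hi)
    have hxN : 0 < x (N + 2) := hx (N + 2) (by simp)
    have hrec := weightedMean_succ hw x N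
    have hb1 : 1 ≤ sumRatio w (N + 2) := one_le_sumRatio hw (N + 1)
    have hc := hcrit (N + 1) _ (Real.rpow_nonneg hA.le (-r))
    rw [sum_range_succ, sum_range_succ _ (N + 1)]
    simp only [add_assoc, one_add_one_eq_two] at *
    generalize sumRatio w (N + 2) = b at *
    generalize weightedMean w x (N + 2) = A at *
    generalize weightedMean w x (N + 1) = A' at *
    have hb0 : 0 < b := by linarith
    have hbδ : 0 < b + δ := by linarith
    have hconv := rpow_neg_convex_comb_le (c := (b - 1) / (b + δ)) (d := (1 + δ) / (b + δ))
      (u := A') (v := x (N + 2) / (1 + δ)) (r := r) (div_nonneg (by linarith) hbδ.le)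
      (by positivity) (by field_simp; ring) hA' (by positivity) hr.le
    have e1 : (b - 1) / (b + δ) * A' + (1 + δ) / (b + δ) * (x (N + 2) / (1 + δ))
        = (1 + δ / b)⁻¹ * A := by
      have : 0 < 1 + δ / b := by positivity
      field_simp
      linarith
    have hpos : 0 < 1 + δ / b := by positivity
    rw [e1, Real.mul_rpow (inv_nonneg.2 hpos.le) hA.le, Real.inv_rpow hpos.le,
      Real.rpow_neg hpos.le, inv_inv, Real.div_rpow hxN.le hκ.le, Real.rpow_neg hκ.le,
      div_inv_eq_mul] at hconv
    have h2 := mul_le_mul_of_nonneg_left hconv (div_nonneg hbδ.le hκ.le)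
    have e2 : (b + δ) / (1 + δ) * ((b - 1) / (b + δ) * A' ^ (-r)
        + (1 + δ) / (b + δ) * (x (N + 2) ^ (-r) * (1 + δ) ^ r))
        = (b - 1) / (1 + δ) * A' ^ (-r) + (1 + δ) ^ r * x (N + 2) ^ (-r) := by
      field_simp
    rw [e2] at h2
    norm_num [add_assoc] at *
    linarith

theorem weightedGeomMean_one (hw : ∀ n, 1 ≤ n → 0 < w n) (a : ℕ → ℝ) :
    weightedGeomMean w a 1 = a 1 := by
  simp [weightedGeomMean, (hw 1 le_rfl).ne']

theorem weightedGeomMean_nonneg {a : ℕ → ℝ} (ha : ∀ n, 1 ≤ n → 0 ≤ a n) (n : ℕ) :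
    0 ≤ weightedGeomMean w a n :=
  prod_nonneg fun i hi => Real.rpow_nonneg (ha i (mem_Icc.1 hi).1) _

theorem weightedGeomMean_succ (hw : ∀ n, 1 ≤ n → 0 < w n) {a : ℕ → ℝ}
    (ha : ∀ n, 1 ≤ n → 0 ≤ a n) (n : ℕ) :
    weightedGeomMean w a (n + 2)
      = weightedGeomMean w a (n + 1) ^ ((sumRatio w (n + 2) - 1) / sumRatio w (n + 2))
        * a (n + 2) ^ (1 / sumRatio w (n + 2)) := by
  have h1 := (hw (n + 2) (by simp)).ne'
  have h2 := (sum_Icc_pos hw n).ne'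
  have h3 := (sum_Icc_pos hw (n + 1)).ne'
  rw [weightedGeomMean, prod_Icc_succ_top (by simp), weightedGeomMean,
    ← Real.finsetProd_rpow _ _ fun i hi => Real.rpow_nonneg (ha i (mem_Icc.1 hi).1) _]
  congr 1
  · refine prod_congr rfl fun i hi => ?_
    rw [← Real.rpow_mul (ha i (mem_Icc.1 hi).1)]
    congr 1
    simp only [sumRatio]
    rw [sum_Icc_succ_top (by simp)] at h3 ⊢
    field_simp
    ring
  · simp [sumRatio]

/-- The analogue of `sum_weightedMean_rpow_neg_add_le` for geometric means: its growth condition and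
its slack are the limits for `r → ∞`, `δ = M / r`. -/
theorem sum_weightedGeomMean_add_le (hw : ∀ n, 1 ≤ n → 0 < w n) {M : ℝ}
    (hb : ∀ n, sumRatio w (n + 2) ≤ sumRatio w (n + 1) * Real.exp (M / sumRatio w (n + 1)))
    {a : ℕ → ℝ} (ha : ∀ n, 1 ≤ n → 0 ≤ a n) (N : ℕ) :
    ∑ n ∈ range (N + 1), weightedGeomMean w a (n + 1)
        + (sumRatio w (N + 2) - 1) * weightedGeomMean w a (N + 1)
      ≤ Real.exp M * ∑ n ∈ range (N + 1), a (n + 1) := by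
  induction N with
  | zero =>
    have h := mul_le_mul_of_nonneg_right (hb 0) (ha 1 le_rfl)
    simp only [zero_add, sumRatio_one hw, div_one, one_mul] at h
    simp only [zero_add, sum_range_one, weightedGeomMean_one hw]
    linarith
  | succ N ih =>
    have hG := weightedGeomMean_nonneg (w := w) ha (N + 2)
    have hG' := weightedGeomMean_nonneg (w := w) ha (N + 1)
    have haN := ha (N + 2) (by simp)
    have hrec := weightedGeomMean_succ hw ha N
    have hb1 : 1 ≤ sumRatio w (N + 2) := one_le_sumRatio hw (N + 1)
    have hc := mul_le_mul_of_nonneg_right (hb (N + 1)) hG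
    rw [sum_range_succ, sum_range_succ _ (N + 1)]
    simp only [add_assoc, one_add_one_eq_two] at *
    generalize sumRatio w (N + 2) = b at *
    generalize weightedGeomMean w a (N + 2) = A at *
    generalize weightedGeomMean w a (N + 1) = A' at *
    have hb0 : 0 < b := by linarith
    -- the weights `(b - 1) / b` and `1 / b` are the exponents in the recurrence for the means
    have hamgm := Real.geom_mean_le_arith_mean2_weighted (w₁ := (b - 1) / b) (w₂ := 1 / b)
      (p₁ := A') (p₂ := Real.exp M * a (N + 2)) (div_nonneg (by linarith) hb0.le)
      (by positivity) hG' (by positivity) (by field_simp; ring)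
    rw [Real.mul_rpow (Real.exp_pos M).le haN, ← Real.exp_mul, mul_one_div] at hamgm
    have h2 := mul_le_mul_of_nonneg_left hamgm hb0.le
    have e2 : b * ((b - 1) / b * A' + 1 / b * (Real.exp M * a (N + 2)))
        = (b - 1) * A' + Real.exp M * a (N + 2) := by field_simp
    have e3 : b * (A' ^ ((b - 1) / b) * (Real.exp (M / b) * a (N + 2) ^ (1 / b)))
        = b * Real.exp (M / b) * A := by rw [hrec]; ring
    rw [e2, e3] at h2
    norm_num [add_assoc] at *
    linarith

end Criteria

/-! ### The ratios for power weights -/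

theorem two_mul_mul_le_rpow_neg_sub {m h : ℝ} (hm : 0 ≤ m) (h0 : 0 ≤ h) (h1 : h < 1) :
    2 * m * h ≤ (1 - h) ^ (-m) - (1 + h) ^ (-m) := by
  let f : ℝ → ℝ := fun h => (1 - h) ^ (-m) - (1 + h) ^ (-m) - 2 * m * h
  let f' : ℝ → ℝ := fun h =>
    -1 * (-m) * (1 - h) ^ (-m - 1) - 1 * (-m) * (1 + h) ^ (-m - 1) - 2 * m * 1
  have hd : ∀ x, 0 ≤ x → x < 1 → HasDerivAt f (f' x) x := by
    intro x hx0 hx1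
    have e1 : HasDerivAt (fun h : ℝ => (1 - h) ^ (-m)) _ x :=
      ((hasDerivAt_id x).const_sub 1).rpow_const (Or.inl (sub_pos.2 hx1).ne')
    have e2 : HasDerivAt (fun h : ℝ => (1 + h) ^ (-m)) _ x :=
      ((hasDerivAt_id x).const_add 1).rpow_const (Or.inl (by simp only [id]; linarith))
    exact (e1.sub e2).sub ((hasDerivAt_id x).const_mul (2 * m))
  have hmono : MonotoneOn f (Set.Ico 0 1) := by
    refine monotoneOn_of_deriv_nonneg (convex_Ico 0 1)
      (fun x hx => (hd x hx.1 hx.2).continuousAt.continuousWithinAt)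
      (fun x hx => (hd x (interior_subset hx).1
        (interior_subset hx).2).differentiableAt.differentiableWithinAt) ?_
    intro x hx
    obtain ⟨hx0, hx1⟩ := interior_subset hx
    rw [(hd x hx0 hx1).deriv]
    have b1 := one_sub_mul_le_rpow_neg (t := 1 - x) (r := m + 1) (by linarith) (by linarith)
    have b2 := one_sub_mul_le_rpow_neg (t := 1 + x) (r := m + 1) (by linarith) (by linarith)
    rw [neg_add'] at b1 b2
    have := mul_nonneg hm (sub_nonneg.2 (add_le_add b1 b2))
    simp only [f']
    linarith
  have h := hmono ⟨le_rfl, zero_lt_one⟩ ⟨h0, h1⟩ h0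
  simp only [f] at h
  norm_num at h
  linarith

/-- For `0 < h` this says `1 - 1 / s ≤ 1 / (1 - (1 - h) ^ s) - 1 / ((1 + h) ^ s - 1)`; with
`h = 1 / n` it is the induction step for the ratios of the weights `n ^ s`. The difference of the
two sides increases with `h`, and `two_mul_mul_le_rpow_neg_sub` is the sign of its derivative. -/
theorem sub_one_mul_mul_le_of_one_le {s h : ℝ} (hs : 1 ≤ s) (h0 : 0 ≤ h) (h1 : h < 1) :
    (s - 1) * (((1 + h) ^ s - 1) * (1 - (1 - h) ^ s)) ≤ s * ((1 + h) ^ s + (1 - h) ^ s - 2) := by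
  let f : ℝ → ℝ := fun h => s * ((1 + h) ^ s + (1 - h) ^ s - 2)
    - (s - 1) * (((1 + h) ^ s - 1) * (1 - (1 - h) ^ s))
  let f' : ℝ → ℝ := fun h => s * (1 * s * (1 + h) ^ (s - 1) + -1 * s * (1 - h) ^ (s - 1))
    - (s - 1) * ((1 * s * (1 + h) ^ (s - 1)) * (1 - (1 - h) ^ s)
      + ((1 + h) ^ s - 1) * -(-1 * s * (1 - h) ^ (s - 1)))
  have hd : ∀ x, 0 ≤ x → x < 1 → HasDerivAt f (f' x) x := by
    intro x hx0 hx1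
    have e1 : HasDerivAt (fun h : ℝ => (1 - h) ^ s) _ x :=
      ((hasDerivAt_id x).const_sub 1).rpow_const (Or.inl (sub_pos.2 hx1).ne')
    have e2 : HasDerivAt (fun h : ℝ => (1 + h) ^ s) _ x :=
      ((hasDerivAt_id x).const_add 1).rpow_const (Or.inl (by simp only [id]; linarith))
    exact (((e2.add e1).sub_const 2).const_mul s).sub
      (((e2.sub_const 1).mul (e1.const_sub 1)).const_mul (s - 1))
  have hmono : MonotoneOn f (Set.Ico 0 1) := by
    refine monotoneOn_of_deriv_nonneg (convex_Ico 0 1)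
      (fun x hx => (hd x hx.1 hx.2).continuousAt.continuousWithinAt)
      (fun x hx => (hd x (interior_subset hx).1
        (interior_subset hx).2).differentiableAt.differentiableWithinAt) ?_
    intro x hx
    obtain ⟨hx0, hx1⟩ := interior_subset hx
    rw [(hd x hx0 hx1).deriv]
    have hp0 : 0 < 1 + x := by linarith
    have hq0 : 0 < 1 - x := by linarith
    have key := two_mul_mul_le_rpow_neg_sub (m := s - 1) (by linarith) hx0 hx1
    have hP : (1 + x) ^ s = (1 + x) * (1 + x) ^ (s - 1) := by
      rw [Real.rpow_sub_one hp0.ne']; field_simp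
    have hQ : (1 - x) ^ s = (1 - x) * (1 - x) ^ (s - 1) := by
      rw [Real.rpow_sub_one hq0.ne']; field_simp
    rw [Real.rpow_neg hp0.le, Real.rpow_neg hq0.le] at key
    simp only [f', hP, hQ]
    have hp : 0 < (1 + x) ^ (s - 1) := Real.rpow_pos_of_pos hp0 _
    have hq : 0 < (1 - x) ^ (s - 1) := Real.rpow_pos_of_pos hq0 _
    generalize (1 + x) ^ (s - 1) = p at *
    generalize (1 - x) ^ (s - 1) = q at *
    -- the derivative equals `s * (p - q - 2 * (s - 1) * x * (p * q))`
    have h := mul_nonneg (mul_nonneg (by linarith : 0 ≤ s) (mul_pos hp hq).le)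
      (sub_nonneg.2 key)
    have e : s * (p * q) * (q⁻¹ - p⁻¹ - 2 * (s - 1) * x)
        = s * (p - q - 2 * (s - 1) * x * (p * q)) := by field_simp
    rw [e] at h
    linarith
  have h := hmono ⟨le_rfl, zero_lt_one⟩ ⟨h0, h1⟩ h0
  simp only [f] at h
  norm_num at h
  linarith

section PowerWeights

variable {α : ℝ}

theorem powerWeight_pos (α : ℝ) : ∀ n : ℕ, 1 ≤ n → 0 < (n : ℝ) ^ (α - 1) :=
  fun _ hn => Real.rpow_pos_of_pos (Nat.cast_pos.2 hn) _

theorem sumRatio_powerWeight_succ (α : ℝ) (n : ℕ) :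
    sumRatio (fun i : ℕ => (i : ℝ) ^ (α - 1)) (n + 2)
      = 1 + sumRatio (fun i : ℕ => (i : ℝ) ^ (α - 1)) (n + 1)
        * (1 - 1 / ((n : ℝ) + 2)) ^ (α - 1) := by
  rw [sumRatio_succ (powerWeight_pos α), ← Real.div_rpow (by positivity) (by positivity)]
  congr 3
  push_cast
  have : (0 : ℝ) < (n : ℝ) + 2 := by positivity
  field_simp
  ring

/-- The quotient `((n + 1) / (n + 2)) ^ s` of two consecutive weights in its two forms: Bernoulli's
inequality applied to one or to the other bounds it from different sides. -/
theorem one_sub_rpow_eq_inv (s : ℝ) (n : ℕ) :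
    (1 - 1 / ((n : ℝ) + 2)) ^ s = ((1 + 1 / ((n : ℝ) + 1)) ^ s)⁻¹ := by
  rw [← Real.inv_rpow (by positivity)]
  congr 1
  have : (0 : ℝ) < (n : ℝ) + 2 := by positivity
  field_simp
  ring

/-- Here the ratio is at most `n / α`, and Bernoulli's inequality for the quotient of two consecutive
weights suffices. -/
theorem sumRatio_powerWeight_le_of_le_one (h0 : 0 < α) (h1 : α ≤ 1) (n : ℕ) :
    sumRatio (fun i : ℕ => (i : ℝ) ^ (α - 1)) (n + 2)
      ≤ sumRatio (fun i : ℕ => (i : ℝ) ^ (α - 1)) (n + 1) + 1 / α := by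
  have hρ : ∀ n : ℕ, (1 - 1 / ((n : ℝ) + 2)) ^ (α - 1) ≤ 1 + (1 - α) * (1 / ((n : ℝ) + 1)) := by
    intro n
    rw [one_sub_rpow_eq_inv, ← Real.rpow_neg (by positivity), neg_sub]
    have h2 : (0 : ℝ) ≤ 1 / ((n : ℝ) + 1) := by positivity
    exact rpow_one_add_le_one_add_mul_self (by linarith) (by linarith) (by linarith)
  have hle : ∀ n : ℕ, sumRatio (fun i : ℕ => (i : ℝ) ^ (α - 1)) (n + 1)
      ≤ ((n : ℝ) + 1) / α := by
    intro n
    induction n with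
    | zero => simpa [sumRatio_one (powerWeight_pos α)] using (one_le_inv₀ h0).2 h1
    | succ n ih =>
      rw [add_assoc, one_add_one_eq_two, sumRatio_powerWeight_succ]
      have hρ0 : 0 ≤ (1 - 1 / ((n : ℝ) + 2)) ^ (α - 1) := by
        rw [one_sub_rpow_eq_inv]; positivity
      have h2 := mul_le_mul ih (hρ n) hρ0 (by positivity)
      have e : ((n : ℝ) + 1) / α * (1 + (1 - α) * (1 / ((n : ℝ) + 1)))
          = (((n + 1 : ℕ) : ℝ) + 1) / α - 1 := by
        push_cast
        field_simp
        ring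
      linarith
  rw [sumRatio_powerWeight_succ]
  have hb : 0 < sumRatio (fun i : ℕ => (i : ℝ) ^ (α - 1)) (n + 1) :=
    zero_lt_one.trans_le (one_le_sumRatio (powerWeight_pos α) n)
  have h2 := mul_le_mul_of_nonneg_left (hρ n) hb.le
  have h3 := mul_le_mul_of_nonneg_right (hle n)
    (by have : 0 ≤ 1 - α := by linarith
        positivity : 0 ≤ (1 - α) * (1 / ((n : ℝ) + 1)))
  have e : ((n : ℝ) + 1) / α * ((1 - α) * (1 / ((n : ℝ) + 1))) = 1 / α - 1 := by
    field_simp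
  linarith

/-- In this range the bound is a lower bound for the ratio `b_n`, proved by induction on `n` from
`sub_one_mul_mul_le_of_one_le`. -/
theorem sumRatio_powerWeight_le_of_two_le (hα : 2 ≤ α) (n : ℕ) :
    sumRatio (fun i : ℕ => (i : ℝ) ^ (α - 1)) (n + 2)
      ≤ sumRatio (fun i : ℕ => (i : ℝ) ^ (α - 1)) (n + 1) + 1 / α := by
  obtain ⟨s, rfl⟩ : ∃ s, α = s + 1 := ⟨α - 1, by ring⟩
  have hs : 1 ≤ s := by linarith
  suffices h : s / (s + 1) ≤ sumRatio (fun i : ℕ => (i : ℝ) ^ (s + 1 - 1)) (n + 1)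
      * (1 - (1 - 1 / ((n : ℝ) + 2)) ^ s) by
    have e : s / (s + 1) = 1 - 1 / (s + 1) := by field_simp; ring
    rw [sumRatio_powerWeight_succ]
    simp only [add_sub_cancel_right] at *
    linarith
  induction n with
  | zero =>
    rw [zero_add, sumRatio_one (powerWeight_pos _), one_sub_rpow_eq_inv, one_mul]
    have h2 := one_add_mul_self_le_rpow_one_add (s := 1) (by norm_num) hs
    norm_num at h2 ⊢
    have h3 : ((2 : ℝ) ^ s)⁻¹ ≤ (1 + s)⁻¹ := inv_anti₀ (by linarith) h2
    have e : s / (s + 1) = 1 - (1 + s)⁻¹ := by field_simp; ring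
    linarith
  | succ n ih =>
    rw [add_assoc n 1 1, one_add_one_eq_two, sumRatio_powerWeight_succ,
      one_sub_rpow_eq_inv s (n + 1)]
    have hcast : ((n + 1 : ℕ) : ℝ) + 1 = (n : ℝ) + 2 := by push_cast; ring
    rw [hcast]
    simp only [add_sub_cancel_right] at *
    have hh0 : 0 < 1 / ((n : ℝ) + 2) := by positivity
    have hh1 : 1 / ((n : ℝ) + 2) < 1 := by
      rw [div_lt_one (by positivity)]; linarith [Nat.cast_nonneg (α := ℝ) n]
    have key := sub_one_mul_mul_le_of_one_le hs hh0.le hh1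
    generalize 1 / ((n : ℝ) + 2) = h at *
    have hP : 1 < (1 + h) ^ s := Real.one_lt_rpow (by linarith) (by linarith)
    have hQ : (1 - h) ^ s < 1 := Real.rpow_lt_one (by linarith) (by linarith) (by linarith)
    have hQ0 : 0 ≤ (1 - h) ^ s := Real.rpow_nonneg (by linarith) _
    generalize (1 + h) ^ s = P at *
    generalize (1 - h) ^ s = Q at *
    generalize sumRatio (fun i : ℕ => (i : ℝ) ^ s) (n + 1) = b at *
    have hQ' : 0 < 1 - Q := by linarith
    have hb : s / (s + 1) / (1 - Q) ≤ b := by rwa [div_le_iff₀ hQ']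
    have hP' : 0 ≤ 1 - P⁻¹ := by linarith [inv_lt_one_of_one_lt₀ hP]
    have h2 := mul_le_mul_of_nonneg_right
      (add_le_add_right (mul_le_mul_of_nonneg_right hb hQ0) 1) hP'
    refine le_trans ?_ h2
    have hP0 : 0 < P := by linarith
    have e : (1 + s / (s + 1) / (1 - Q) * Q) * (1 - P⁻¹) - s / (s + 1)
        = (s * (P + Q - 2) - (s - 1) * ((P - 1) * (1 - Q))) / ((s + 1) * (1 - Q) * P) := by
      field_simp
      ring
    have h3 : 0 ≤ (s * (P + Q - 2) - (s - 1) * ((P - 1) * (1 - Q))) / ((s + 1) * (1 - Q) * P) :=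
      div_nonneg (by linarith) (by positivity)
    linarith

theorem sumRatio_powerWeight_le_of_one_le_of_le_two (h1 : 1 ≤ α) (h2 : α ≤ 2) (n : ℕ) :
    sumRatio (fun i : ℕ => (i : ℝ) ^ (α - 1)) (n + 2)
      ≤ sumRatio (fun i : ℕ => (i : ℝ) ^ (α - 1)) (n + 1) + 1 / α
        + 1 / (2 * α ^ 2 * sumRatio (fun i : ℕ => (i : ℝ) ^ (α - 1)) (n + 1)) := by
  obtain ⟨s, rfl⟩ : ∃ s, α = s + 1 := ⟨α - 1, by ring⟩
  simp only [add_sub_cancel_right]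
  have hw := powerWeight_pos (s + 1)
  have hsucc := sumRatio_powerWeight_succ (s + 1)
  simp only [add_sub_cancel_right] at hw hsucc
  have hs0 : 0 ≤ s := by linarith
  have hs1 : s ≤ 1 := by linarith
  have hρ0 : ∀ n : ℕ, 0 ≤ (1 - 1 / ((n : ℝ) + 2)) ^ s := by
    intro n; rw [one_sub_rpow_eq_inv]; positivity
  have hρle : ∀ n : ℕ, (1 - 1 / ((n : ℝ) + 2)) ^ s ≤ 1 - s / ((n : ℝ) + 2) := by
    intro n
    have hh : 1 / ((n : ℝ) + 2) ≤ 1 := by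
      rw [div_le_one (by positivity)]; linarith [Nat.cast_nonneg (α := ℝ) n]
    have h := rpow_one_add_le_one_add_mul_self (s := -(1 / ((n : ℝ) + 2))) (by linarith) hs0 hs1
    rw [← sub_eq_add_neg] at h
    calc _ ≤ _ := h
      _ = _ := by ring
  have hρge : ∀ n : ℕ, (1 + s / ((n : ℝ) + 1))⁻¹ ≤ (1 - 1 / ((n : ℝ) + 2)) ^ s := by
    intro n
    rw [one_sub_rpow_eq_inv]
    have hh : 0 ≤ 1 / ((n : ℝ) + 1) := by positivity
    have h := rpow_one_add_le_one_add_mul_self (s := 1 / ((n : ℝ) + 1)) (by linarith) hs0 hs1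
    rw [mul_one_div] at h
    exact inv_anti₀ (by positivity) h
  have hlower : ∀ n : ℕ, ((n : ℝ) + 1 + s) / (s + 1)
      ≤ sumRatio (fun i : ℕ => (i : ℝ) ^ s) (n + 1) := by
    intro n
    induction n with
    | zero =>
      rw [zero_add, sumRatio_one hw, div_le_one (by linarith)]
      simp [add_comm]
    | succ n ih =>
      rw [add_assoc n 1 1, one_add_one_eq_two, hsucc]
      have h3 := mul_le_mul ih (hρge n) (by positivity) (le_trans (by positivity) ih)
      have e : ((n : ℝ) + 1 + s) / (s + 1) * (1 + s / ((n : ℝ) + 1))⁻¹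
          = (((n + 1 : ℕ) : ℝ) + 1 + s) / (s + 1) - 1 := by
        have : (0 : ℝ) < (n : ℝ) + 1 := by positivity
        push_cast
        field_simp
        ring
      linarith
  have hupper : ∀ n : ℕ, sumRatio (fun i : ℕ => (i : ℝ) ^ s) (n + 1) ≤ (n : ℝ) + 1 := by
    intro n
    induction n with
    | zero => simp [sumRatio_one hw]
    | succ n ih =>
      rw [add_assoc n 1 1, one_add_one_eq_two, hsucc]
      have hρ1 : (1 - 1 / ((n : ℝ) + 2)) ^ s ≤ 1 := (hρle n).trans (by
        have : 0 ≤ s / ((n : ℝ) + 2) := by positivity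
        linarith)
      have h3 := mul_le_mul ih hρ1 (hρ0 n) (by positivity)
      push_cast
      linarith
  rw [hsucc]
  have hl := hlower n
  have hu := hupper n
  have hb := one_le_sumRatio hw n
  have hρ := hρle n
  generalize sumRatio (fun i : ℕ => (i : ℝ) ^ s) (n + 1) = b at *
  have hN : (0 : ℝ) ≤ n := Nat.cast_nonneg n
  generalize (n : ℝ) = N at *
  have hb0 : 0 < b := by linarith
  have h3 := mul_le_mul_of_nonneg_left hρ hb0.le
  have h4 : s / (N + 2) * ((N + 1 + s) / (s + 1)) ≤ s / (N + 2) * b :=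
    mul_le_mul_of_nonneg_left hl (by positivity)
  have h5 : 1 / (2 * (s + 1) ^ 2 * (N + 1)) ≤ 1 / (2 * (s + 1) ^ 2 * b) :=
    one_div_le_one_div_of_le (by positivity) (mul_le_mul_of_nonneg_left hu (by positivity))
  -- the loss `s * (1 - s) / ((s + 1) * (N + 2))` of the lower bound for the ratio is made up
  -- for by the quadratic term, because `2 * s * (1 - s) * (1 + s) ≤ 1` on the unit interval
  have h6 : s * (1 - s) / ((s + 1) * (N + 2)) ≤ 1 / (2 * (s + 1) ^ 2 * (N + 1)) := by
    rw [div_le_div_iff₀ (by positivity) (by positivity)]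
    have hc : 2 * s * (1 - s) * (1 + s) ≤ 1 := by
      nlinarith [mul_nonneg hs0 (sq_nonneg (s - 1 / 2)), sq_nonneg (s - 1 / 2),
        mul_nonneg hs0 (sub_nonneg.2 hs1)]
    have h7 := mul_le_mul_of_nonneg_right hc (by positivity : 0 ≤ (s + 1) * (N + 1))
    have h8 : (s + 1) * (N + 1) ≤ (s + 1) * (N + 2) :=
      mul_le_mul_of_nonneg_left (by linarith) (by linarith)
    linarith
  have e : s / (N + 2) * ((N + 1 + s) / (s + 1)) + s * (1 - s) / ((s + 1) * (N + 2))
      = 1 - 1 / (s + 1) := by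
    field_simp
    ring
  have e2 : b * (1 - s / (N + 2)) = b - s / (N + 2) * b := by ring
  linarith

theorem sumRatio_powerWeight_le_of_one_le (hα : 1 ≤ α) (n : ℕ) :
    sumRatio (fun i : ℕ => (i : ℝ) ^ (α - 1)) (n + 2)
      ≤ sumRatio (fun i : ℕ => (i : ℝ) ^ (α - 1)) (n + 1) + 1 / α
        + 1 / (2 * α ^ 2 * sumRatio (fun i : ℕ => (i : ℝ) ^ (α - 1)) (n + 1)) := by
  rcases le_total α 2 with h | h
  · exact sumRatio_powerWeight_le_of_one_le_of_le_two hα h n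
  · refine (sumRatio_powerWeight_le_of_two_le h n).trans (le_add_of_nonneg_right ?_)
    have := one_le_sumRatio (powerWeight_pos α) n
    positivity

theorem sumRatio_powerWeight_le_mul_exp (hα : 1 ≤ α) (n : ℕ) :
    sumRatio (fun i : ℕ => (i : ℝ) ^ (α - 1)) (n + 2)
      ≤ sumRatio (fun i : ℕ => (i : ℝ) ^ (α - 1)) (n + 1)
        * Real.exp (1 / α / sumRatio (fun i : ℕ => (i : ℝ) ^ (α - 1)) (n + 1)) := by
  refine (sumRatio_powerWeight_le_of_one_le hα n).trans ?_
  have hb := one_le_sumRatio (powerWeight_pos α) n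
  generalize sumRatio (fun i : ℕ => (i : ℝ) ^ (α - 1)) (n + 1) = b at *
  have hb0 : 0 < b := by linarith
  have h := mul_le_mul_of_nonneg_left
    (Real.quadratic_le_exp_of_nonneg (by positivity : 0 ≤ 1 / α / b)) hb0.le
  refine le_trans (le_of_eq ?_) h
  field_simp

/-- The growth condition of `sum_weightedMean_rpow_neg_add_le` for power weights. -/
theorem sumRatio_powerWeight_add_le (hα : 0 < α) {r : ℝ} (hr : 0 < r) (n : ℕ) :
    sumRatio (fun i : ℕ => (i : ℝ) ^ (α - 1)) (n + 2) + 1 / (α * r)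
      ≤ (sumRatio (fun i : ℕ => (i : ℝ) ^ (α - 1)) (n + 1) + 1 / (α * r))
        * (1 + 1 / (α * r) / sumRatio (fun i : ℕ => (i : ℝ) ^ (α - 1)) (n + 1)) ^ r := by
  have hb := one_le_sumRatio (powerWeight_pos α) n
  have hb0 := zero_lt_one.trans_le hb
  have e1 : ∀ b : ℝ, 0 < b → (b + 1 / (α * r)) * (1 + 1 / (α * r) / b) ^ r
      = b * (1 + 1 / (α * b) / r) ^ (1 + r) := by
    intro b hb
    have e : 1 / (α * r) / b = 1 / (α * b) / r := by field_simp
    rw [Real.rpow_add (by positivity), Real.rpow_one, e]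
    field_simp
  rw [e1 _ hb0]
  rcases le_total α 1 with h | h
  · have h1 := sumRatio_powerWeight_le_of_le_one hα h n
    generalize sumRatio (fun i : ℕ => (i : ℝ) ^ (α - 1)) (n + 1) = b at *
    have h2 : 0 ≤ 1 / (α * b) / r := by positivity
    have h3 := mul_le_mul_of_nonneg_left (one_add_mul_self_le_rpow_one_add
      (s := 1 / (α * b) / r) (by linarith) (by linarith : 1 ≤ 1 + r)) hb0.le
    refine le_trans ?_ h3
    have e : b * (1 + (1 + r) * (1 / (α * b) / r)) = b + 1 / α + 1 / (α * r) := by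
      field_simp
      ring
    linarith
  · have h1 := sumRatio_powerWeight_le_of_one_le h n
    generalize sumRatio (fun i : ℕ => (i : ℝ) ^ (α - 1)) (n + 1) = b at *
    have hy : 1 / (α * b) ≤ 1 := by
      rw [div_le_one (by positivity)]
      exact one_le_mul_of_one_le_of_one_le h hb
    have h3 := mul_le_mul_of_nonneg_left
      (quadratic_le_rpow_one_add hr (by positivity : 0 ≤ 1 / (α * b)) hy) hb0.le
    refine le_trans ?_ h3
    have e : b * (1 + 1 / (α * b) + 1 / (α * b) / r + (1 / (α * b)) ^ 2 / 2)
        = b + 1 / α + 1 / (2 * α ^ 2 * b) + 1 / (α * r) := by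
      field_simp
      ring
    linarith

end PowerWeights

/-! ### The two inequalities -/

theorem weightedPowerMean_eq_zero {w : ℕ → ℝ} {p : ℝ} {a : ℕ → ℝ} {n : ℕ}
    (h : ∃ i ∈ Icc 1 n, a i = 0) : weightedPowerMean w p a n = 0 :=
  if_pos h

theorem weightedPowerMean_eq_of_pos {w : ℕ → ℝ} {p : ℝ} {a : ℕ → ℝ} {n : ℕ}
    (h : ∀ i ∈ Icc 1 n, 0 < a i) :
    weightedPowerMean w p a n = weightedMean w (fun i => a i ^ (1 / p)) n ^ p :=
  if_neg fun ⟨i, hi, h0⟩ => (h i hi).ne' h0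

theorem weightedPowerMean_nonneg {w : ℕ → ℝ} (hw : ∀ n, 1 ≤ n → 0 < w n) (p : ℝ) {a : ℕ → ℝ}
    (ha : ∀ n, 1 ≤ n → 0 ≤ a n) (n : ℕ) : 0 ≤ weightedPowerMean w p a n := by
  unfold weightedPowerMean
  split_ifs
  · exact le_rfl
  · exact Real.rpow_nonneg (div_nonneg
      (sum_nonneg fun i hi => mul_nonneg (hw i (mem_Icc.1 hi).1).le
        (Real.rpow_nonneg (ha i (mem_Icc.1 hi).1) _))
      (sum_nonneg fun i hi => (hw i (mem_Icc.1 hi).1).le)) _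

theorem sum_range_weightedPowerMean_le {p α : ℝ} (hp : p < 0) (hα : 0 < α) {a : ℕ → ℝ}
    (ha : ∀ n, 1 ≤ n → 0 ≤ a n) (N : ℕ) :
    ∑ n ∈ range N, weightedPowerMean (fun i : ℕ => (i : ℝ) ^ (α - 1)) p a (n + 1)
      ≤ (α * p / (α * p - 1)) ^ p * ∑ n ∈ range N, a (n + 1) := by
  obtain ⟨r, rfl⟩ : ∃ r, p = -r := ⟨-p, by ring⟩
  have hr : 0 < r := by linarith
  have hw := powerWeight_pos α
  have hδ : 0 < 1 / (α * r) := by positivity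
  have hK : (α * -r / (α * -r - 1)) ^ (-r) = (1 + 1 / (α * r)) ^ r := by
    have e : α * -r / (α * -r - 1) = (1 + 1 / (α * r))⁻¹ := by
      have h1 : α * -r - 1 = -(α * r + 1) := by ring
      have h2 : 0 < α * r + 1 := by positivity
      rw [h1, mul_neg, neg_div_neg_eq]
      field_simp
    rw [e, Real.inv_rpow (by positivity), Real.rpow_neg (by positivity), inv_inv]
  rw [hK]
  induction N with
  | zero => simp
  | succ N ih =>
    -- once a term of `a` vanishes all later power means are `0`, so the bound for the partial sums
    -- is inherited; otherwise the bound for positive sequences applies directly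
    by_cases hz : ∃ i ∈ Icc 1 (N + 1), a i = 0
    · rw [sum_range_succ, sum_range_succ, weightedPowerMean_eq_zero hz, mul_add, add_zero]
      have := ha (N + 1) (by simp)
      exact ih.trans (le_add_of_nonneg_right (by positivity))
    · have hpos : ∀ i ∈ Icc 1 (N + 1), 0 < a i := fun i hi =>
        (ha i (mem_Icc.1 hi).1).lt_of_ne' fun h => hz ⟨i, hi, h⟩
      have h := sum_weightedMean_rpow_neg_add_le hw hr hδ (sumRatio_powerWeight_add_le hα hr)
        (x := fun i => a i ^ (1 / -r)) N fun i hi => Real.rpow_pos_of_pos (hpos i hi) _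
      have hslack : 0 ≤ (sumRatio (fun i : ℕ => (i : ℝ) ^ (α - 1)) (N + 2) - 1) / (1 + 1 / (α * r))
          * weightedMean (fun i : ℕ => (i : ℝ) ^ (α - 1)) (fun i => a i ^ (1 / -r)) (N + 1)
            ^ (-r) := by
        refine mul_nonneg (div_nonneg (sub_nonneg.2 (one_le_sumRatio hw (N + 1))) (by positivity))
          (Real.rpow_nonneg (weightedMean_pos hw fun i hi => ?_).le _)
        exact Real.rpow_pos_of_pos (hpos i hi) _
      have hsub : ∀ n ∈ range (N + 1), ∀ i ∈ Icc 1 (n + 1), 0 < a i := fun n hn i hi =>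
        hpos i (Icc_subset_Icc_right (by simpa [Nat.lt_succ_iff] using hn) hi)
      have e1 := sum_congr rfl fun n hn =>
        weightedPowerMean_eq_of_pos (w := fun i : ℕ => (i : ℝ) ^ (α - 1)) (p := -r) (hsub n hn)
      have e2 : ∑ n ∈ range (N + 1), (a (n + 1) ^ (1 / -r)) ^ (-r)
          = ∑ n ∈ range (N + 1), a (n + 1) := by
        refine sum_congr rfl fun n _ => ?_
        rw [← Real.rpow_mul (ha _ (by simp)), one_div_mul_cancel (by linarith), Real.rpow_one]
      rw [e2] at h
      rw [e1]
      linarith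

theorem sum_range_weightedGeomMean_le {α : ℝ} (hα : 0 ≤ α) {a : ℕ → ℝ}
    (ha : ∀ n, 1 ≤ n → 0 ≤ a n) (N : ℕ) :
    ∑ n ∈ range N, weightedGeomMean (fun k : ℕ => (k : ℝ) ^ α) a (n + 1)
      ≤ Real.exp (1 / (α + 1)) * ∑ n ∈ range N, a (n + 1) := by
  cases N with
  | zero => simp
  | succ N =>
    have hw := powerWeight_pos (α + 1)
    have hb := sumRatio_powerWeight_le_mul_exp (α := α + 1) (by linarith)
    simp only [add_sub_cancel_right] at hw hb
    have h := sum_weightedGeomMean_add_le hw hb ha N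
    have hslack := mul_nonneg (sub_nonneg.2 (one_le_sumRatio hw (N + 1)))
      (weightedGeomMean_nonneg (w := fun k : ℕ => (k : ℝ) ^ α) ha (N + 1))
    linarith

theorem summable_and_tsum_le_of_sum_range_le {f g : ℕ → ℝ} {C : ℝ} (hC : 0 ≤ C)
    (hf : ∀ n, 0 ≤ f n) (hg : ∀ n, 0 ≤ g n) (hs : Summable g)
    (h : ∀ N, ∑ n ∈ range N, f n ≤ C * ∑ n ∈ range N, g n) :
    Summable f ∧ ∑' n, f n ≤ C * ∑' n, g n := by
  have h' : ∀ N, ∑ n ∈ range N, f n ≤ C * ∑' n, g n := fun N =>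
    (h N).trans (mul_le_mul_of_nonneg_left (hs.sum_le_tsum _ fun n _ => hg n) hC)
  exact ⟨summable_of_sum_range_le hf h', Real.tsum_le_of_sum_range_le hf h'⟩

theorem mainTheorem2 :
    (∀ p α : ℝ, p < 0 → 0 < α →
      ∀ a : ℕ → ℝ, (∀ n, 1 ≤ n → 0 ≤ a n) → Summable (fun n : ℕ => a (n + 1)) →
        Summable (fun n : ℕ =>
          weightedPowerMean (fun i : ℕ => (i : ℝ) ^ (α - 1)) p a (n + 1)) ∧
        ∑' n : ℕ, weightedPowerMean (fun i : ℕ => (i : ℝ) ^ (α - 1)) p a (n + 1)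
          ≤ (α * p / (α * p - 1)) ^ p * ∑' n : ℕ, a (n + 1)) ∧
    (∀ α : ℝ, 0 < α → α < 1 →
      ∀ a : ℕ → ℝ, (∀ n, 1 ≤ n → 0 ≤ a n) → Summable (fun n : ℕ => a (n + 1)) →
        Summable (fun n : ℕ =>
          weightedGeomMean (fun k : ℕ => (k : ℝ) ^ α) a (n + 1)) ∧
        ∑' n : ℕ, weightedGeomMean (fun k : ℕ => (k : ℝ) ^ α) a (n + 1)
          ≤ Real.exp (1 / (α + 1)) * ∑' n : ℕ, a (n + 1)) := by
  refine ⟨fun p α hp hα a ha hs => ?_, fun α hα _ a ha hs => ?_⟩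
  · refine summable_and_tsum_le_of_sum_range_le (Real.rpow_nonneg ?_ _)
      (fun n => weightedPowerMean_nonneg (powerWeight_pos α) p ha _)
      (fun n => ha _ (by simp)) hs (sum_range_weightedPowerMean_le hp hα ha)
    have := mul_neg_of_pos_of_neg hα hp
    exact div_nonneg_of_nonpos this.le (by linarith)
  · exact summable_and_tsum_le_of_sum_range_le (Real.exp_pos _).le
      (fun n => weightedGeomMean_nonneg ha _) (fun n => ha _ (by simp)) hs
      (sum_range_weightedGeomMean_le hα.le ha)
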